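/- Let $n\ge 1$ be an integer, let $K$ be an algebraically closed field (of any characteristic), and let $\mathbb G_m^n=(K\setminus\{0\})^n$ with coordinatewise multiplication. Let $X\subset\mathbb G_m^n$ be an algebraic subset, that is, the set of common zeros in $\mathbb G_m^n$ of finitely many Laurent polynomials in $K[X_1^{\pm1},\dots,X_n^{\pm1}]$, and suppose that $X$ has dimension $d$ (the Krull dimension of its coordinate ring $K[X_1^{\pm1},\dots,X_n^{\pm1}]/I(X)$, where $I(X)$ is the ideal of all Laurent polynomials vanishing on $X$), $d\ge 0$. For a real number $T\ge1$ let $$X_T=\{\boldsymbol\zeta\in X:\ \boldsymbol\zeta \text{ has finite order in } \mathbb G_m^n \text{ and } \mathrm{ord}(\boldsymbol\zeta)\le T\}.$$ Then there is a constant $C$, depending only on $X$, such that for all real $T\ge 1$ the set $X_T$ is finite and $\#X_T\le C\,T^{d+1}$. -/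

import Mathlib

namespace TorusTorsion

/-- The group of `K`-points of the `n`-dimensional algebraic torus, `(K \ {0})ⁿ`. -/
abbrev Torus (K : Type*) [Field K] (n : ℕ) : Type _ := Fin n → Kˣ

/-- The ring of Laurent polynomials in `n` variables over `K`, realised as the group algebra
of `ℤⁿ`: the basis element at `a` is the monomial `X₁ ^ a₁ ⋯ Xₙ ^ aₙ`. -/
abbrev Laurent (K : Type*) [Field K] (n : ℕ) : Type _ := AddMonoidAlgebra K (Fin n → ℤ)

/-- For a point `x` of the torus, the character `a ↦ x₁ ^ a₁ ⋯ xₙ ^ aₙ` of `ℤⁿ`. -/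
def monomialAt {K : Type*} [Field K] {n : ℕ} (x : Torus K n) :
    Multiplicative (Fin n → ℤ) →* K where
  toFun a := ∏ i, ((x i ^ (Multiplicative.toAdd a i) : Kˣ) : K)
  map_one' := by simp
  map_mul' a b := by simp [zpow_add, Finset.prod_mul_distrib]

/-- Evaluation of Laurent polynomials at a point of the torus. -/
noncomputable def evalAt {K : Type*} [Field K] {n : ℕ} (x : Torus K n) : Laurent K n →ₐ[K] K :=
  AddMonoidAlgebra.lift K K (Fin n → ℤ) (monomialAt x)

/-- A set of points of the torus is algebraic if it is the set of common zeros of finitely many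
Laurent polynomials. -/
def IsAlgebraic {K : Type*} [Field K] {n : ℕ} (X : Set (Torus K n)) : Prop :=
  ∃ S : Finset (Laurent K n), X = {x | ∀ P ∈ S, evalAt x P = 0}

/-- The ideal of all Laurent polynomials that vanish on `X`. -/
noncomputable def vanishingIdeal {K : Type*} [Field K] {n : ℕ} (X : Set (Torus K n)) :
    Ideal (Laurent K n) :=
  ⨅ x ∈ X, RingHom.ker (evalAt x)

/-- The dimension of `X`: the Krull dimension of its coordinate ring
(`⊥` for the empty set, whose coordinate ring is zero). -/
noncomputable def dim {K : Type*} [Field K] {n : ℕ} (X : Set (Torus K n)) : WithBot ℕ∞ :=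
  ringKrullDim (Laurent K n ⧸ vanishingIdeal X)

/-- The set of torsion points in `X` of order at most `T`. -/
def torsionUpTo {K : Type*} [Field K] {n : ℕ} (X : Set (Torus K n)) (T : ℝ) :
    Set (Torus K n) :=
  {ζ | ζ ∈ X ∧ IsOfFinOrder ζ ∧ (orderOf ζ : ℝ) ≤ T}

end TorusTorsion

namespace TorusTorsion

open MvPolynomial

/-! Fix `N` and let `W` be the span, in the coordinate ring of `X`, of the monomials with exponents
in `[0, N)`. At an `N`-torsion point a monomial depends only on its exponents mod `N`, so a linear
relation on `W` between evaluations at such points is a relation between characters of `ℤⁿ`.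
Dedekind's independence of characters forbids it, so `X` has at most `dim W` such points
(`ncard_pow_eq_one_le_finrank`). Noether normalization gives `dim W = O(N ^ d)`
(`exists_finrank_span_monomials_le`); summing over `N ≤ T` gives the exponent `d + 1`. -/

/-- Krull dimension does not drop along an injective integral extension (lying over and
going up). -/
theorem ringKrullDim_le_of_isIntegral {R S : Type*} [CommRing R] [CommRing S] [Algebra R S]
    [Algebra.IsIntegral R S] (hinj : Function.Injective (algebraMap R S)) :
    ringKrullDim R ≤ ringKrullDim S := by
  have : Algebra.HasGoingUp R S := by
    refine ⟨fun {q} _ P _ hlt => ?_⟩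
    obtain ⟨Q, hPQ, hQ, hc⟩ := Ideal.exists_ideal_over_prime_of_isIntegral q P hlt.le
    exact ⟨Q, hPQ, hQ, ⟨hc.symm⟩⟩
  refine iSup_le fun l => ?_
  -- Lying over for the bottom of the chain; going up then lifts the rest.
  obtain ⟨Q, -, hQ, hc⟩ := Ideal.exists_ideal_over_prime_of_isIntegral l.head.asIdeal (⊥ : Ideal S)
    (by rw [← RingHom.ker_eq_comap_bot, (RingHom.injective_iff_ker_eq_bot _).1 hinj]; exact bot_le)
  have : Q.LiesOver (RelSeries.head l).asIdeal := ⟨hc.symm⟩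
  obtain ⟨L, hL, -⟩ := Ideal.exists_ltSeries_of_hasGoingUp l Q
  rw [← hL]
  exact le_iSup (fun L : LTSeries (PrimeSpectrum S) => ((L.length : ℕ) : WithBot ℕ∞)) L

/-- Noether normalization in terms of the Krull dimension. -/
theorem exists_finite_algHom_le_ringKrullDim (k A : Type*) [Field k] [CommRing A] [Nontrivial A]
    [Algebra k A] [Algebra.FiniteType k A] {d : ℕ} (hd : ringKrullDim A = d) :
    ∃ s ≤ d, ∃ g : MvPolynomial (Fin s) k →ₐ[k] A, g.Finite := by
  obtain ⟨s, g, hinj, hfin⟩ := exists_finite_inj_algHom_of_fg k A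
  refine ⟨s, ?_, g, hfin⟩
  let := g.toRingHom.toAlgebra
  have : Module.Finite (MvPolynomial (Fin s) k) A := hfin
  have h := ringKrullDim_le_of_isIntegral (R := MvPolynomial (Fin s) k) (S := A) hinj
  rw [MvPolynomial.ringKrullDim_of_isNoetherianRing, ringKrullDim_eq_zero_of_field, hd] at h
  simpa using h

section Growth

variable {k A : Type*} [Field k] [CommRing A] [Algebra k A] {s r n : ℕ}

/-- The combinations of the elements `e` with coefficients of total degree at most `M`. -/
def HasDegreeLE (g : MvPolynomial (Fin s) k →ₐ[k] A) (e : Fin r → A) (M : ℕ) (y : A) : Prop :=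
  ∃ b : Fin r → MvPolynomial (Fin s) k, (∀ j, (b j).totalDegree ≤ M) ∧ y = ∑ j, g (b j) * e j

theorem exists_hasDegreeLE {g : MvPolynomial (Fin s) k →ₐ[k] A} {e : Fin r → A}
    (he : ∀ y, ∃ b : Fin r → MvPolynomial (Fin s) k, y = ∑ j, g (b j) * e j)
    {ι : Type*} [Finite ι] (y : ι → A) : ∃ M, ∀ i, HasDegreeLE g e M (y i) := by
  cases nonempty_fintype ι
  choose b hb using fun i => he (y i)
  refine ⟨Finset.univ.sup fun i => Finset.univ.sup fun j => (b i j).totalDegree, fun i => ?_⟩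
  refine ⟨b i, fun j => ?_, hb i⟩
  exact (Finset.le_sup (f := fun j => (b i j).totalDegree) (Finset.mem_univ j)).trans
    (Finset.le_sup (f := fun i => Finset.univ.sup fun j => (b i j).totalDegree)
      (Finset.mem_univ i))

theorem HasDegreeLE.mono {g : MvPolynomial (Fin s) k →ₐ[k] A} {e : Fin r → A} {M M' : ℕ} {y : A}
    (h : HasDegreeLE g e M y) (hM : M ≤ M') : HasDegreeLE g e M' y := by
  obtain ⟨b, hb, rfl⟩ := h
  exact ⟨b, fun j => (hb j).trans hM, rfl⟩

/-- Multiplication by `x` acts on the generators `e` through a matrix with entries of degree at most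
`D`, so it raises coefficient degrees by at most `D`. -/
theorem HasDegreeLE.mul {g : MvPolynomial (Fin s) k →ₐ[k] A} {e : Fin r → A} {M D : ℕ} {x y : A}
    (h : HasDegreeLE g e M y) (hx : ∀ j, HasDegreeLE g e D (x * e j)) :
    HasDegreeLE g e (M + D) (x * y) := by
  obtain ⟨b, hb, rfl⟩ := h
  choose c hc hxc using hx
  refine ⟨fun l => ∑ j, b j * c j l, fun l => ?_, ?_⟩
  · refine totalDegree_finsetSum_le fun j _ => ?_
    exact (totalDegree_mul _ _).trans (add_le_add (hb j) (hc j l))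
  · simp only [map_sum, map_mul, Finset.sum_mul]
    rw [Finset.sum_comm, Finset.mul_sum]
    refine Finset.sum_congr rfl fun j _ => ?_
    rw [mul_left_comm, hxc, Finset.mul_sum]
    exact Finset.sum_congr rfl fun l _ => by ring

theorem HasDegreeLE.pow_mul {g : MvPolynomial (Fin s) k →ₐ[k] A} {e : Fin r → A} {M D : ℕ}
    {x y : A} (h : HasDegreeLE g e M y) (hx : ∀ j, HasDegreeLE g e D (x * e j)) (m : ℕ) :
    HasDegreeLE g e (M + m * D) (x ^ m * y) := by
  induction m with
  | zero => simpa using h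
  | succ m ih =>
    rw [pow_succ', mul_assoc, add_mul, one_mul, ← add_assoc]
    exact ih.mul hx

theorem HasDegreeLE.prod_pow {g : MvPolynomial (Fin s) k →ₐ[k] A} {e : Fin r → A} {M D : ℕ}
    {x : Fin n → A} (h : HasDegreeLE g e M 1) (hx : ∀ i j, HasDegreeLE g e D (x i * e j))
    (a : Fin n → ℕ) : HasDegreeLE g e (M + (∑ i, a i) * D) (∏ i, x i ^ a i) := by
  suffices ∀ t : Finset (Fin n), HasDegreeLE g e (M + (∑ i ∈ t, a i) * D) (∏ i ∈ t, x i ^ a i) from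
    this _
  intro t
  induction t using Finset.induction_on with
  | empty => simpa using h
  | insert i t hi ih =>
    rw [Finset.prod_insert hi, Finset.sum_insert hi, add_comm (a i), add_mul, ← add_assoc]
    exact ih.pow_mul (hx i) _

theorem HasDegreeLE.mem_span {g : MvPolynomial (Fin s) k →ₐ[k] A} {e : Fin r → A} {M : ℕ} {y : A}
    (h : HasDegreeLE g e M y) :
    y ∈ Submodule.span k (Set.range fun p : (Fin s → Fin (M + 1)) × Fin r =>
      g (monomial (Finsupp.equivFunOnFinite.symm fun i => (p.1 i : ℕ)) 1) * e p.2) := by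
  obtain ⟨b, hb, rfl⟩ := h
  refine Submodule.sum_mem _ fun j _ => ?_
  rw [(b j).as_sum, map_sum, Finset.sum_mul]
  refine Submodule.sum_mem _ fun a ha => ?_
  have hlt : ∀ i, a i < M + 1 := fun i =>
    Nat.lt_succ_of_le ((Finsupp.le_degree i a).trans ((le_totalDegree ha).trans (hb j)))
  have hm : monomial a (coeff a (b j)) = coeff a (b j) • monomial a (1 : k) := by
    simp [smul_monomial]
  rw [hm, map_smul, smul_mul_assoc]
  have ha' : (Finsupp.equivFunOnFinite.symm fun i => a i) = a := by ext; rfl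
  refine Submodule.smul_mem _ _ (Submodule.subset_span ⟨(fun i => ⟨a i, hlt i⟩, j), ?_⟩)
  dsimp only
  rw [ha']

end Growth

/-- In a finitely generated algebra of Krull dimension `d`, the monomials of partial degrees
less than `N` in given elements span a space of dimension `O(N ^ d)`. -/
theorem exists_finrank_span_monomials_le (k : Type*) {A : Type*} [Field k] [CommRing A]
    [Algebra k A] [Algebra.FiniteType k A] {d n : ℕ} (hd : ringKrullDim A = d) (x : Fin n → A) :
    ∃ C : ℕ, ∀ N : ℕ, 1 ≤ N →
      Module.finrank k (Submodule.span k (Set.range fun a : Fin n → Fin N =>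
        ∏ i, x i ^ (a i : ℕ))) ≤ C * N ^ d := by
  have : Nontrivial A := by
    by_contra h
    rw [not_nontrivial_iff_subsingleton] at h
    rw [ringKrullDim_eq_bot_of_subsingleton] at hd
    exact absurd hd (WithBot.bot_ne_coe (a := (d : ℕ∞)))
  obtain ⟨s, hs, g, hg⟩ := exists_finite_algHom_le_ringKrullDim k A hd
  obtain ⟨r, e, he⟩ : ∃ (r : ℕ) (e : Fin r → A),
      ∀ y, ∃ b : Fin r → MvPolynomial (Fin s) k, y = ∑ j, g (b j) * e j := by
    let := g.toRingHom.toAlgebra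
    have : Module.Finite (MvPolynomial (Fin s) k) A := hg
    obtain ⟨r, e, he⟩ := Module.Finite.exists_fin (R := MvPolynomial (Fin s) k) (M := A)
    refine ⟨r, e, fun y => ?_⟩
    obtain ⟨b, hb⟩ := (Submodule.mem_span_range_iff_exists_fun _).1 (he ▸ Submodule.mem_top (x := y))
    exact ⟨b, hb.symm⟩
  obtain ⟨M, hM⟩ := exists_hasDegreeLE he fun _ : Unit => (1 : A)
  obtain ⟨D, hD⟩ := exists_hasDegreeLE he fun p : Fin n × Fin r => x p.1 * e p.2
  -- `M` bounds the degrees for `1` and `D` those for each `x i * e j`. A monomial in the box has at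
  -- most `n * N` factors, hence degree at most `M + n * N * D`.
  refine ⟨(M + n * D + 1) ^ s * r, fun N hN => ?_⟩
  have hle : Submodule.span k (Set.range fun a : Fin n → Fin N => ∏ i, x i ^ (a i : ℕ)) ≤
      Submodule.span k (Set.range fun p : (Fin s → Fin (M + n * N * D + 1)) × Fin r =>
        g (monomial (Finsupp.equivFunOnFinite.symm fun i => (p.1 i : ℕ)) 1) * e p.2) := by
    rw [Submodule.span_le]
    rintro _ ⟨a, rfl⟩
    refine (((hM ()).prod_pow (fun i j => hD (i, j)) fun i => (a i : ℕ)).mono ?_).mem_span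
    gcongr
    simpa using Finset.sum_le_card_nsmul Finset.univ (fun i => (a i : ℕ)) N
      fun i _ => (a i).2.le
  have hfd := FiniteDimensional.span_of_finite k
    (Set.finite_range fun p : (Fin s → Fin (M + n * N * D + 1)) × Fin r =>
        g (monomial (Finsupp.equivFunOnFinite.symm fun i => (p.1 i : ℕ)) 1) * e p.2)
  calc _ ≤ _ := Submodule.finrank_mono hle
    _ ≤ _ := finrank_range_le_card _
    _ = (M + n * N * D + 1) ^ s * r := by simp
    _ ≤ ((M + n * D + 1) * N) ^ s * r := by
      gcongr
      nlinarith [Nat.mul_le_mul_left M hN]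
    _ = (M + n * D + 1) ^ s * r * N ^ s := by rw [mul_pow]; ring
    _ ≤ _ := by gcongr

variable {K : Type*} [Field K] {n : ℕ}

theorem evalAt_single (x : Torus K n) (a : Fin n → ℤ) (c : K) :
    evalAt x (AddMonoidAlgebra.single a c) = c * ∏ i, ((x i ^ a i : Kˣ) : K) := by
  simp [evalAt, monomialAt]

theorem monomialAt_injective : Function.Injective (monomialAt (K := K) (n := n)) := by
  intro x y h
  funext i
  have := DFunLike.congr_fun h (Multiplicative.ofAdd (Pi.single i 1))
  simp only [monomialAt, MonoidHom.coe_mk, OneHom.coe_mk, toAdd_ofAdd, ← Units.coe_prod,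
    Units.val_inj] at this
  simpa [Pi.single_apply, Finset.prod_ite_eq, apply_ite (fun m : ℤ => x _ ^ m), pow_ite] using this

/-- Evaluation of functions on `X` at a point of `X`. -/
noncomputable def evalOn (X : Set (Torus K n)) (x : X) :
    (Laurent K n ⧸ vanishingIdeal X) →ₐ[K] K :=
  Ideal.Quotient.liftₐ _ (evalAt x.1) fun _ ha => by
    simp only [vanishingIdeal, Submodule.mem_iInf] at ha
    exact ha x.1 x.2

theorem finite_pow_eq_one {N : ℕ} (hN : 1 ≤ N) : {x : Torus K n | x ^ N = 1}.Finite := by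
  have : NeZero N := ⟨by omega⟩
  have h : (Set.univ.pi fun _ : Fin n => {u : Kˣ | u ^ N = 1}).Finite := by
    refine Set.Finite.pi fun _ => ?_
    have : Finite (rootsOfUnity N K) := inferInstance
    exact Set.toFinite (rootsOfUnity N K : Set Kˣ)
  refine h.subset fun x hx i _ => ?_
  exact congrFun hx i

theorem prod_zpow_eq_prod_pow_emod {N : ℕ} (hN : 1 ≤ N) {x : Torus K n} (hx : x ^ N = 1)
    (a : Fin n → ℤ) : ∏ i, ((x i ^ a i : Kˣ) : K) = ∏ i, ((x i : K) ^ (a i % N).toNat) := by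
  refine Finset.prod_congr rfl fun i _ => ?_
  have hi : x i ^ N = 1 := congrFun hx i
  have h0 : 0 ≤ a i % N := Int.emod_nonneg _ (by omega)
  rw [← Units.val_pow_eq_pow_val, ← zpow_natCast, Int.toNat_of_nonneg h0, ← zpow_eq_zpow_emod' _ hi]

/-- The `N`-torsion points on `X` are bounded in number by the dimension of the space spanned by
the monomials of partial degrees less than `N` in the coordinate ring. -/
theorem ncard_pow_eq_one_le_finrank (X : Set (Torus K n)) {N : ℕ} (hN : 1 ≤ N) :
    {x | x ∈ X ∧ x ^ N = 1}.ncard ≤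
      Module.finrank K (Submodule.span K (Set.range fun a : Fin n → Fin N =>
        ∏ i, (Ideal.Quotient.mk (vanishingIdeal X)
          (AddMonoidAlgebra.single (Pi.single i 1) 1)) ^ (a i : ℕ))) := by
  set W := Submodule.span K (Set.range fun a : Fin n → Fin N =>
        ∏ i, (Ideal.Quotient.mk (vanishingIdeal X)
          (AddMonoidAlgebra.single (Pi.single i 1) 1)) ^ (a i : ℕ))
  have : FiniteDimensional K W := FiniteDimensional.span_of_finite K (Set.finite_range _)
  set F := {x | x ∈ X ∧ x ^ N = 1}
  have hfin : F.Finite := (finite_pow_eq_one hN).subset fun x hx => hx.2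
  have := hfin.fintype
  have hli : LinearIndependent K fun x : F =>
      ((evalOn X ⟨x.1, x.2.1⟩).toLinearMap.domRestrict W : Module.Dual K W) := by
    rw [Fintype.linearIndependent_iff]
    intro c hc
    -- Dedekind: distinct points give distinct, hence independent, characters.
    have hchar := (linearIndependent_monoidHom (Multiplicative (Fin n → ℤ)) K).comp
      (fun x : F => monomialAt x.1) (monomialAt_injective.comp Subtype.val_injective)
    rw [Fintype.linearIndependent_iff] at hchar
    refine hchar c (funext fun a => ?_)
    have hlt : ∀ i, (Multiplicative.toAdd a i % N).toNat < N := fun i => by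
      have := Int.emod_lt_of_pos (Multiplicative.toAdd a i) (b := N) (by omega)
      omega
    -- Test the relation on the monomial with exponents reduced mod `N`, which lies in `W`.
    have := LinearMap.congr_fun hc ⟨_, Submodule.subset_span ⟨fun i => ⟨_, hlt i⟩, rfl⟩⟩
    simp only [LinearMap.sum_apply, LinearMap.smul_apply, LinearMap.domRestrict_apply,
      LinearMap.zero_apply, AlgHom.toLinearMap_apply, map_prod, map_pow] at this
    simp only [Finset.sum_apply, Pi.smul_apply, Function.comp_apply, Pi.zero_apply]
    rw [← this]
    refine Finset.sum_congr rfl fun x _ => ?_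
    congr 1
    refine (prod_zpow_eq_prod_pow_emod hN x.2.2 _).trans (Finset.prod_congr rfl fun i _ => ?_)
    congr 1
    change _ = evalAt x.1 _
    rw [evalAt_single, one_mul, Finset.prod_eq_single i] <;> simp +contextual
  have h := hli.fintype_card_le_finrank
  rwa [Subspace.dual_finrank_eq, ← Nat.card_eq_fintype_card, Nat.card_coe_set_eq] at h

end TorusTorsion

theorem proposition1p3 {K : Type*} [Field K] [IsAlgClosed K] {n : ℕ}
    (X : Set (TorusTorsion.Torus K n)) (hX : TorusTorsion.IsAlgebraic X)
    (d : ℕ) (hd : TorusTorsion.dim X = d) :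
    ∃ C : ℝ, ∀ T : ℝ, 1 ≤ T →
      (TorusTorsion.torsionUpTo X T).Finite ∧
        ((TorusTorsion.torsionUpTo X T).ncard : ℝ) ≤ C * T ^ (d + 1) := by
  obtain ⟨C, hC⟩ := TorusTorsion.exists_finrank_span_monomials_le K hd fun i =>
    Ideal.Quotient.mk (TorusTorsion.vanishingIdeal X) (AddMonoidAlgebra.single (Pi.single i 1) 1)
  refine ⟨C, fun T hT => ?_⟩
  -- A point of order `N` is counted among the `N`-torsion points; overcounting is harmless.
  have hsub : TorusTorsion.torsionUpTo X T ⊆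
      ⋃ N ∈ Finset.Icc 1 ⌊T⌋₊, {x | x ∈ X ∧ x ^ N = 1} := by
    rintro x ⟨hxX, hfin, hord⟩
    simp only [Set.mem_iUnion]
    exact ⟨orderOf x, Finset.mem_Icc.2 ⟨hfin.orderOf_pos, Nat.le_floor hord⟩, hxX,
      pow_orderOf_eq_one x⟩
  have hfinite : (⋃ N ∈ Finset.Icc 1 ⌊T⌋₊, {x | x ∈ X ∧ x ^ N = 1}).Finite :=
    (Finset.finite_toSet _).biUnion fun N hN =>
      (TorusTorsion.finite_pow_eq_one (Finset.mem_Icc.1 hN).1).subset fun x hx => hx.2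
  refine ⟨hfinite.subset hsub, ?_⟩
  have hcard : (TorusTorsion.torsionUpTo X T).ncard ≤ C * ⌊T⌋₊ ^ (d + 1) :=
    calc _ ≤ _ := Set.ncard_le_ncard hsub hfinite
      _ ≤ ∑ N ∈ Finset.Icc 1 ⌊T⌋₊, {x | x ∈ X ∧ x ^ N = 1}.ncard :=
        Finset.set_ncard_biUnion_le _ _
      _ ≤ ∑ N ∈ Finset.Icc 1 ⌊T⌋₊, C * ⌊T⌋₊ ^ d := by
        refine Finset.sum_le_sum fun N hN => ?_
        obtain ⟨h1, h2⟩ := Finset.mem_Icc.1 hN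
        refine ((TorusTorsion.ncard_pow_eq_one_le_finrank X h1).trans (hC N h1)).trans ?_
        gcongr
      _ = _ := by simp; ring
  calc ((TorusTorsion.torsionUpTo X T).ncard : ℝ) ≤ C * (⌊T⌋₊ : ℝ) ^ (d + 1) := by
        exact_mod_cast hcard
    _ ≤ C * T ^ (d + 1) := by
        gcongr
        exact Nat.floor_le (by linarith)
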